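/- Let $d\ge 1$ and let $\mu$ be a Borel probability measure on $\mathbb{R}^d$ that is absolutely continuous with respect to Lebesgue measure and whose support $\mathcal{S}$ (the smallest closed set of $\mu$-measure one) is convex. For a probability measure $\nu'$ on $\mathbb{R}^d$, let $Q_{\nu'}$ be the optimal transport map from $\mu$ to $\nu'$, that is, the ($\mu$-almost everywhere unique) measurable map that pushes $\mu$ forward to $\nu'$ and is $\mu$-almost everywhere the gradient of a convex function $\psi:\mathbb{R}^d\to\mathbb{R}\cup\{\infty\}$. For $u\in\mathbb{R}^d$, let $$H\!D(u,\mu)=\inf\{\mu(H): H \text{ a closed halfspace of } \mathbb{R}^d \text{ containing } u\}$$ be the Tukey halfspace depth of $u$ with respect to $\mu$. Let $\nu=\sum_{i=1}^n\lambda_i\delta_{x_i}$ be a probability measure with pairwise distinct atoms $x_1,\dots,x_n\in\mathbb{R}^d$ and weights $\lambda_1,\dots,\lambda_n>0$. For $u\in\mathcal{S}$, the breakdown point of $Q_\nu(u)$ is $$\mathrm{BDP}(Q_\nu(u))=\min\Big\{\sum_{i\in I}\lambda_i : I\subset\{1,\dots,n\} \text{ such that } \sup_{\tilde\nu_I}\int_{\mathcal{B}_\delta(u)}\|Q_\nu(x)-Q_{\tilde\nu_I}(x)\|\,d\mu(x)=\infty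 \text{ for all } \delta>0\Big\},$$ where $\mathcal{B}_\delta(u)$ is the open ball with center $u$ and radius $\delta$, and where the supremum is over all finitely discrete probability measures $\tilde\nu_I$ on $\mathbb{R}^d$ whose atoms include the $x_i$ with $i\notin I$ and that satisfy $\tilde\nu_I(\{x_i\})=\lambda_i$ for all $i\notin I$. Fix $u\in\mathcal{S}$. Then the following hold. (i) The minimum that defines $\mathrm{BDP}(Q_\nu(u))$ is attained, and $$\mathrm{BDP}(Q_\nu(u))=\min\Big\{\sum_{i\in I}\lambda_i : \emptyset\ne I\subset\{1,\dots,n\} \text{ such that } \sum_{i\in I}\lambda_i\ge H\!D(u,\mu)\Big\}.$$ (ii) If $\nu$ is empirical, that is, if $\lambda_1=\dots=\lambda_n=1/n$, then $$\mathrm{BDP}(Q_\nu(u))=\lceil n\,H\!D(u,\mu)\rceil/n,$$ where $\lceil t\rceil$ is the smallest integer that is at least $t$ if $t\ne 0$, and $\lceil 0\rceil=1$. In particular, if $\nu_n$ is, for each $n\ge 1$, an empirical measure with $n$ pairwise distinct atoms (which may change arbitrarily with $n$), then $\mathrm{BDP}(Q_{\nu_n}(u))\to H\!D(u,\mu)$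 as $n\to\infty$. -/

import Mathlib

open MeasureTheory Filter Topology

namespace SemiDiscreteOT

/-- A closed halfspace of `ℝ^d`: a set `{z | c ≤ ⟪v, z⟫}` with `v ≠ 0`. -/
def IsClosedHalfspace {d : ℕ} (H : Set (EuclideanSpace ℝ (Fin d))) : Prop :=
  ∃ (v : EuclideanSpace ℝ (Fin d)) (c : ℝ), v ≠ 0 ∧ H = {z | c ≤ inner ℝ v z}

/-- Tukey's halfspace depth of `u` with respect to `μ`: the infimum of the `μ`-measures of the
closed halfspaces that contain `u`. -/
noncomputable def halfspaceDepth {d : ℕ} (μ : Measure (EuclideanSpace ℝ (Fin d)))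
    (u : EuclideanSpace ℝ (Fin d)) : ℝ :=
  sInf {m : ℝ | ∃ H : Set (EuclideanSpace ℝ (Fin d)),
    IsClosedHalfspace H ∧ u ∈ H ∧ m = μ.real H}

/-- `T` is (a representative of) the optimal transport map from `μ` to `ν` in the sense of
Brenier and McCann: `T` is measurable, pushes `μ` forward to `ν`, and is `μ`-almost everywhere
the gradient of a convex function with values in `ℝ ∪ {∞}`. The convex function is given by the
convex set `D` where it is finite and by its values `ψ` on `D`; such a function can be
differentiable only at interior points of `D`. -/
def IsOTMap {d : ℕ} (μ ν : Measure (EuclideanSpace ℝ (Fin d)))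
    (T : EuclideanSpace ℝ (Fin d) → EuclideanSpace ℝ (Fin d)) : Prop :=
  Measurable T ∧ μ.map T = ν ∧
    ∃ (D : Set (EuclideanSpace ℝ (Fin d))) (ψ : EuclideanSpace ℝ (Fin d) → ℝ),
      ConvexOn ℝ D ψ ∧ ∀ᵐ x ∂μ, x ∈ interior D ∧ HasGradientAt ψ (T x) x

open Classical in
/-- The optimal transport map `Q_ν` from the reference measure `μ` to the target measure `ν`.
When `μ` is an absolutely continuous probability measure and `ν` a probability measure, it exists
and is unique up to `μ`-null sets, so that the choice of a representative is immaterial below. -/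
noncomputable def otMap {d : ℕ} (μ ν : Measure (EuclideanSpace ℝ (Fin d))) :
    EuclideanSpace ℝ (Fin d) → EuclideanSpace ℝ (Fin d) :=
  if h : ∃ T, IsOTMap μ ν T then h.choose else 0

/-- The discrete measure `∑ i, lam i • δ_{x i}`. -/
noncomputable def discreteMeasure {d n : ℕ} (x : Fin n → EuclideanSpace ℝ (Fin d))
    (lam : Fin n → ℝ) : Measure (EuclideanSpace ℝ (Fin d)) :=
  ∑ i, ENNReal.ofReal (lam i) • Measure.dirac (x i)

/-- The contaminated target measures: all probability measures `∑ y ∈ s, w y • δ_y` with a finite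
set `s` of atoms that includes the uncontaminated atoms `x i`, `i ∉ I`, and that give each of
these its original mass `lam i`. -/
def contaminations {d n : ℕ} (x : Fin n → EuclideanSpace ℝ (Fin d)) (lam : Fin n → ℝ)
    (I : Finset (Fin n)) : Set (Measure (EuclideanSpace ℝ (Fin d))) :=
  {ν' | ∃ (s : Finset (EuclideanSpace ℝ (Fin d))) (w : EuclideanSpace ℝ (Fin d) → ℝ),
    (∀ y ∈ s, 0 < w y) ∧ ∑ y ∈ s, w y = 1 ∧
    ν' = ∑ y ∈ s, ENNReal.ofReal (w y) • Measure.dirac y ∧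
    (∀ i, i ∉ I → x i ∈ s) ∧
    ∀ i, i ∉ I → ν' {x i} = ENNReal.ofReal (lam i)}

/-- Contaminating the atoms with indices in `I` breaks `Q_ν(u)` down, where
`ν = ∑ i, lam i • δ_{x i}`. -/
def BreaksDown {d n : ℕ} (μ : Measure (EuclideanSpace ℝ (Fin d)))
    (x : Fin n → EuclideanSpace ℝ (Fin d)) (lam : Fin n → ℝ) (u : EuclideanSpace ℝ (Fin d))
    (I : Finset (Fin n)) : Prop :=
  ∀ δ : ℝ, 0 < δ →
    ⨆ ν' ∈ contaminations x lam I,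
      ∫⁻ y in Metric.ball u δ, ‖otMap μ (discreteMeasure x lam) y - otMap μ ν' y‖ₑ ∂μ = ⊤

/-- The total masses of contamination that break `Q_ν(u)` down. -/
def breakdownMasses {d n : ℕ} (μ : Measure (EuclideanSpace ℝ (Fin d)))
    (x : Fin n → EuclideanSpace ℝ (Fin d)) (lam : Fin n → ℝ)
    (u : EuclideanSpace ℝ (Fin d)) : Set ℝ :=
  {m | ∃ I : Finset (Fin n), BreaksDown μ x lam u I ∧ m = ∑ i ∈ I, lam i}

/-- The breakdown point of `Q_ν(u)`, where `ν = ∑ i, lam i • δ_{x i}`: the smallest total mass of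
contamination that breaks `Q_ν(u)` down. -/
noncomputable def breakdownPoint {d n : ℕ} (μ : Measure (EuclideanSpace ℝ (Fin d)))
    (x : Fin n → EuclideanSpace ℝ (Fin d)) (lam : Fin n → ℝ)
    (u : EuclideanSpace ℝ (Fin d)) : ℝ :=
  sInf (breakdownMasses μ x lam u)

/-- The ceiling function, modified so that it takes the value `1` at `0`. -/
noncomputable def modCeil (t : ℝ) : ℤ :=
  if t = 0 then 1 else ⌈t⌉

end SemiDiscreteOT

namespace SemiDiscreteOT

/-! ### Null hyperplanes, attainment of the depth, monotonicity of gradients. -/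

section Monotone

variable {d : ℕ} {μ : Measure (EuclideanSpace ℝ (Fin d))}

/-! Everything reduces to `breaksDown_iff`: contaminating `I` causes breakdown exactly when `I` is
nonempty and its mass `m` is at least the depth of `u`. Of a transport map only two properties are
used: it has the prescribed image measure, and, being a gradient of a convex function, it is
monotone, `0 ≤ ⟪T a - T b, a - b⟫`, off a null set.

If `m` is at least the depth, let the unit vector `v` be normal to a halfspace of least mass through
`u`, and move the mass `m` to one atom `t • v` with `t` large. Monotonicity forces the preimage of
this atom to be almost an upper level set of `⟪v, ·⟫`, up to an error that vanishes as `t` grows.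
Having mass `m`, it must contain, up to a null set, a part of the ball around `u` that has positive
measure and does not depend on `t` (`exists_levels`, `exists_forall_eq_far_atom`). The integral is
then at least of order `t`.

If `m` is below the depth, a very long value `T z₀` at some `z₀` near `u` would, by monotonicity,
exclude the uncontaminated values from almost a whole halfspace whose boundary is near `u`. Its mass
exceeds `m`, so less than `1 - m` would remain for those values
(`exists_norm_le_of_lt_halfspaceDepth`). Hence all contaminated maps are uniformly bounded near `u`.

Absolute continuity makes hyperplanes null, so halfspace masses are continuous and compactness of
the sphere applies. Power cells provide existence of the maps, so that `otMap` is not its default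
value `0` where a far atom is needed. -/

theorem measure_hyperplane (hac : μ ≪ volume) {v : EuclideanSpace ℝ (Fin d)} (hv : v ≠ 0)
    (c : ℝ) : μ {z | inner ℝ v z = c} = 0 := by
  apply hac
  rcases Set.eq_empty_or_nonempty {z : EuclideanSpace ℝ (Fin d) | inner ℝ v z = c} with h | ⟨p, hp⟩
  · rw [h]; simp
  have hp : inner ℝ v p = c := hp
  have key := Measure.addHaar_affineSubspace (volume : Measure (EuclideanSpace ℝ (Fin d)))
    (AffineSubspace.mk' p (innerSL ℝ v).toLinearMap.ker) (by
      intro h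
      have h1 : p + v ∈ AffineSubspace.mk' p (innerSL ℝ v).toLinearMap.ker := by rw [h]; trivial
      rw [AffineSubspace.mem_mk'] at h1
      simp at h1
      exact hv h1)
  convert key using 2
  ext z
  simp [AffineSubspace.mem_mk', inner_sub_right, hp, sub_eq_zero]

theorem tendsto_measureReal_of_ae_eventually_iff [IsProbabilityMeasure μ] {ι : Type*} {L : Filter ι}
    [L.IsCountablyGenerated] {s : ι → Set (EuclideanSpace ℝ (Fin d))}
    {t : Set (EuclideanSpace ℝ (Fin d))} (ht : MeasurableSet t) (hs : ∀ i, MeasurableSet (s i))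
    (h : ∀ᵐ z ∂μ, ∀ᶠ i in L, z ∈ s i ↔ z ∈ t) :
    Tendsto (fun i => μ.real (s i)) L (𝓝 (μ.real t)) :=
  (ENNReal.tendsto_toReal (measure_ne_top μ t)).comp
    (tendsto_measure_of_ae_tendsto_indicator_of_isFiniteMeasure L ht hs h)

theorem ae_inner_ne (hac : μ ≪ volume) {v : EuclideanSpace ℝ (Fin d)} (hv : v ≠ 0) (c : ℝ) :
    ∀ᵐ z ∂μ, inner ℝ v z ≠ c :=
  ae_iff.2 (by simpa using measure_hyperplane hac hv c)

theorem ae_inner_sub_ne (hac : μ ≪ volume) (u : EuclideanSpace ℝ (Fin d))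
    {v : EuclideanSpace ℝ (Fin d)} (hv : v ≠ 0) (c : ℝ) :
    ∀ᵐ z ∂μ, inner ℝ v (z - u) ≠ c := by
  filter_upwards [ae_inner_ne hac hv (c + inner ℝ v u)] with z hz h
  apply hz
  rw [← h, inner_sub_right]; ring

theorem measurableSet_openHalfspace (v u : EuclideanSpace ℝ (Fin d)) (c : ℝ) :
    MeasurableSet {z | c < inner ℝ v (z - u)} :=
  (isOpen_lt continuous_const (by fun_prop)).measurableSet

theorem measurableSet_closedHalfspace (v u : EuclideanSpace ℝ (Fin d)) (c : ℝ) :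
    MeasurableSet {z | c ≤ inner ℝ v (z - u)} :=
  (isClosed_le continuous_const (by fun_prop)).measurableSet

theorem measureReal_openHalfspace (hac : μ ≪ volume) (u : EuclideanSpace ℝ (Fin d))
    {v : EuclideanSpace ℝ (Fin d)} (hv : v ≠ 0) (c : ℝ) :
    μ.real {z | c < inner ℝ v (z - u)} = μ.real {z | c ≤ inner ℝ v (z - u)} := by
  apply measureReal_congr
  filter_upwards [ae_inner_sub_ne hac u hv c] with z hz
  exact propext ⟨fun h => le_of_lt h, fun h => lt_of_le_of_ne h hz.symm⟩

theorem continuousAt_measureReal_openHalfspace [IsProbabilityMeasure μ]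
    (hac : μ ≪ volume) (u : EuclideanSpace ℝ (Fin d))
    {v : EuclideanSpace ℝ (Fin d)} (hv : v ≠ 0) (c : ℝ) :
    ContinuousAt (fun p : EuclideanSpace ℝ (Fin d) × ℝ =>
      μ.real {z | p.2 < inner ℝ p.1 (z - u)}) (v, c) := by
  refine tendsto_measureReal_of_ae_eventually_iff (measurableSet_openHalfspace v u c)
    (s := fun p : EuclideanSpace ℝ (Fin d) × ℝ => {z | p.2 < inner ℝ p.1 (z - u)})
    (fun p => measurableSet_openHalfspace p.1 u p.2) ?_
  filter_upwards [ae_inner_sub_ne hac u hv c] with z hz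
  have h1 : ContinuousAt (fun p : EuclideanSpace ℝ (Fin d) × ℝ => p.2) (v, c) := continuousAt_snd
  have h2 : ContinuousAt (fun p : EuclideanSpace ℝ (Fin d) × ℝ => inner ℝ p.1 (z - u)) (v, c) := by
    fun_prop
  rcases lt_or_gt_of_ne hz with h | h
  · filter_upwards [h2.eventually_lt h1 h] with p hp
    exact ⟨fun h' => absurd h' (not_lt.2 hp.le), fun h' => absurd h' (not_lt.2 h.le)⟩
  · filter_upwards [h1.eventually_lt h2 h] with p hp
    exact ⟨fun _ => h, fun _ => hp⟩

theorem bddBelow_halfspace_masses (u : EuclideanSpace ℝ (Fin d)) :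
    BddBelow {m : ℝ | ∃ H : Set (EuclideanSpace ℝ (Fin d)),
      IsClosedHalfspace H ∧ u ∈ H ∧ m = μ.real H} :=
  ⟨0, by rintro m ⟨H, -, -, rfl⟩; exact measureReal_nonneg⟩

theorem halfspaceDepth_le (u : EuclideanSpace ℝ (Fin d)) {v : EuclideanSpace ℝ (Fin d)}
    (hv : v ≠ 0) : halfspaceDepth μ u ≤ μ.real {z | 0 ≤ inner ℝ v (z - u)} := by
  apply csInf_le (bddBelow_halfspace_masses u)
  refine ⟨_, ⟨v, inner ℝ v u, hv, ?_⟩, ?_, rfl⟩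
  · ext z; simp [inner_sub_right]
  · simp

/-- The mass of the halfspace through `u` is continuous in its normal, hence minimal somewhere on
the compact unit sphere; `0 < d` makes the sphere nonempty. -/
theorem exists_measureReal_eq_halfspaceDepth [IsProbabilityMeasure μ] (hd : 0 < d)
    (hac : μ ≪ volume)
    (u : EuclideanSpace ℝ (Fin d)) :
    ∃ v : EuclideanSpace ℝ (Fin d), ‖v‖ = 1 ∧
      μ.real {z | 0 ≤ inner ℝ v (z - u)} = halfspaceDepth μ u := by
  have : Nonempty (Fin d) := ⟨⟨0, hd⟩⟩
  have hne : (Metric.sphere (0 : EuclideanSpace ℝ (Fin d)) 1).Nonempty :=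
    NormedSpace.sphere_nonempty.2 zero_le_one
  have hcont : ContinuousOn (fun v : EuclideanSpace ℝ (Fin d) =>
      μ.real {z | 0 < inner ℝ v (z - u)}) (Metric.sphere 0 1) := by
    intro v hv
    have hv0 : v ≠ 0 := by
      rintro rfl
      simp at hv
    have h := continuousAt_measureReal_openHalfspace hac u hv0 0
    exact (ContinuousAt.comp (f := fun w : EuclideanSpace ℝ (Fin d) => (w, (0 : ℝ)))
      h (by fun_prop)).continuousWithinAt
  obtain ⟨v, hv, hmin⟩ := (isCompact_sphere _ _).exists_isMinOn hne hcont
  have hv1 : ‖v‖ = 1 := by simpa using hv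
  have hv0 : v ≠ 0 := by
    rintro rfl
    simp at hv1
  refine ⟨v, hv1, le_antisymm (le_csInf ⟨_, _, ⟨v, inner ℝ v u, hv0, rfl⟩,
    le_refl (inner ℝ v u), rfl⟩ ?_)
    (halfspaceDepth_le u hv0)⟩
  rintro m ⟨H, ⟨w, c, hw, rfl⟩, hu, rfl⟩
  have hwn : 0 < ‖w‖ := norm_pos_iff.2 hw
  -- A competitor containing `u` also contains the parallel open halfspace with `u` on its boundary,
  -- so boundaries through `u` suffice.
  have h1 := hmin (a := ‖w‖⁻¹ • w) (by simp [norm_smul, hwn.ne'])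
  rw [← measureReal_openHalfspace hac u hv0]
  refine le_trans h1 (measureReal_mono ?_)
  intro z hz
  have hz : 0 < inner ℝ (‖w‖⁻¹ • w) (z - u) := hz
  rw [real_inner_smul_left, inner_sub_right] at hz
  have h2 := (mul_pos_iff_of_pos_left (inv_pos.2 hwn)).1 hz
  have hu : c ≤ inner ℝ w u := hu
  show c ≤ inner ℝ w z
  linarith

/-- On the segment from `a` to `b` the slope of the convex function lies between its derivatives at
the two ends. -/
theorem inner_gradient_sub_nonneg {D : Set (EuclideanSpace ℝ (Fin d))}
    {ψ : EuclideanSpace ℝ (Fin d) → ℝ} (hψ : ConvexOn ℝ D ψ)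
    {a b p q : EuclideanSpace ℝ (Fin d)} (ha : a ∈ D) (hb : b ∈ D)
    (hp : HasGradientAt ψ p a) (hq : HasGradientAt ψ q b) :
    0 ≤ inner ℝ (p - q) (a - b) := by
  have hline : ∀ t : ℝ, HasDerivAt (fun s : ℝ => AffineMap.lineMap a b s) (b - a) t := fun t => by
    simpa using AffineMap.hasDerivAt_lineMap (a := a) (b := b) (x := t)
  have hc := hψ.comp_affineMap (AffineMap.lineMap (k := ℝ) a b)
  have h0 : HasDerivAt (ψ ∘ (AffineMap.lineMap (k := ℝ) a b)) (inner ℝ p (b - a)) 0 := by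
    have := HasFDerivAt.comp_hasDerivAt_of_eq (0 : ℝ) hp.hasFDerivAt (hline 0) (by simp)
    simpa using this
  have h1 : HasDerivAt (ψ ∘ (AffineMap.lineMap (k := ℝ) a b)) (inner ℝ q (b - a)) 1 := by
    have := HasFDerivAt.comp_hasDerivAt_of_eq (1 : ℝ) hq.hasFDerivAt (hline 1) (by simp)
    simpa using this
  have m0 : (0 : ℝ) ∈ (AffineMap.lineMap (k := ℝ) a b) ⁻¹' D := by simpa using ha
  have m1 : (1 : ℝ) ∈ (AffineMap.lineMap (k := ℝ) a b) ⁻¹' D := by simpa using hb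
  have e0 := hc.le_slope_of_hasDerivAt m0 m1 one_pos h0
  have e1 := hc.slope_le_of_hasDerivAt m0 m1 one_pos h1
  have : inner ℝ (p - q) (a - b) = inner ℝ q (b - a) - inner ℝ p (b - a) := by
    simp only [inner_sub_left, inner_sub_right]; ring
  linarith

theorem IsOTMap.exists_monotone {ν : Measure (EuclideanSpace ℝ (Fin d))}
    {T : EuclideanSpace ℝ (Fin d) → EuclideanSpace ℝ (Fin d)} (hT : IsOTMap μ ν T) :
    ∃ G : Set (EuclideanSpace ℝ (Fin d)), (∀ᵐ z ∂μ, z ∈ G) ∧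
      ∀ a ∈ G, ∀ b ∈ G, 0 ≤ inner ℝ (T a - T b) (a - b) := by
  obtain ⟨-, -, D, ψ, hψ, hae⟩ := hT
  exact ⟨{z | z ∈ interior D ∧ HasGradientAt ψ (T z) z}, hae, fun a ha b hb =>
    inner_gradient_sub_nonneg hψ (interior_subset ha.1) (interior_subset hb.1) ha.2 hb.2⟩

theorem isOTMap_otMap_or_eq_zero (ν : Measure (EuclideanSpace ℝ (Fin d))) :
    IsOTMap μ ν (otMap μ ν) ∨ otMap μ ν = 0 := by
  unfold otMap
  split_ifs with h
  · exact Or.inl h.choose_spec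
  · exact Or.inr rfl

theorem isOTMap_otMap {ν : Measure (EuclideanSpace ℝ (Fin d))} (h : ∃ T, IsOTMap μ ν T) :
    IsOTMap μ ν (otMap μ ν) := by
  unfold otMap
  rw [dif_pos h]
  exact h.choose_spec

end Monotone

/-! ### Semidiscrete optimal transport through power cells. -/

section Existence

variable {d : ℕ} {μ : Measure (EuclideanSpace ℝ (Fin d))} {ι : Type*}

/-- The open power cell of the site `y j` for the heights `h`. -/
def powerCell (y : ι → EuclideanSpace ℝ (Fin d)) (h : ι → ℝ) (j : ι) :
    Set (EuclideanSpace ℝ (Fin d)) :=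
  {z | ∀ k, k ≠ j → inner ℝ (y k) z + h k < inner ℝ (y j) z + h j}

theorem isOpen_powerCell [Finite ι] (y : ι → EuclideanSpace ℝ (Fin d)) (h : ι → ℝ) (j : ι) :
    IsOpen (powerCell y h j) := by
  have : powerCell y h j =
      ⋂ k, ⋂ (_ : k ≠ j), {z | inner ℝ (y k) z + h k < inner ℝ (y j) z + h j} := by
    ext z; simp [powerCell]
  rw [this]
  exact isOpen_iInter_of_finite fun k => isOpen_iInter_of_finite fun _ =>
    isOpen_lt (by fun_prop) (by fun_prop)

theorem pairwise_disjoint_powerCell (y : ι → EuclideanSpace ℝ (Fin d)) (h : ι → ℝ) :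
    Pairwise (Function.onFun Disjoint (powerCell y h)) := by
  intro i j hij
  exact Set.disjoint_left.2 fun z hi hj => lt_asymm (hi j hij.symm) (hj i hij)

theorem powerCell_anti {y : ι → EuclideanSpace ℝ (Fin d)} {h h' : ι → ℝ} {j : ι}
    (hle : ∀ k, h k ≤ h' k) (hj : h j = h' j) : powerCell y h' j ⊆ powerCell y h j := by
  intro z hz k hk
  linarith [hz k hk, hle k]

theorem ae_power_ne [Finite ι] (hac : μ ≪ volume) {y : ι → EuclideanSpace ℝ (Fin d)}
    (hy : Function.Injective y) (h : ι → ℝ) :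
    ∀ᵐ z ∂μ, ∀ j k, k ≠ j → inner ℝ (y k) z + h k ≠ inner ℝ (y j) z + h j := by
  refine ae_all_iff.2 fun j => ae_all_iff.2 fun k => ?_
  by_cases hk : k = j
  · exact ae_of_all _ fun z h' => absurd hk h'
  filter_upwards [ae_inner_ne hac (sub_ne_zero.2 (hy.ne hk)) (h j - h k)] with z hz _ he
  apply hz
  rw [inner_sub_left]; linarith

theorem ae_exists_mem_powerCell [Finite ι] [Nonempty ι] (hac : μ ≪ volume)
    {y : ι → EuclideanSpace ℝ (Fin d)} (hy : Function.Injective y) (h : ι → ℝ) :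
    ∀ᵐ z ∂μ, ∃ j, z ∈ powerCell y h j := by
  filter_upwards [ae_power_ne hac hy h] with z hz
  obtain ⟨j, hj⟩ := Finite.exists_max fun k => inner ℝ (y k) z + h k
  exact ⟨j, fun k hk => lt_of_le_of_ne (hj k) (hz j k hk)⟩

variable [Fintype ι] [IsProbabilityMeasure μ]

theorem continuous_measureReal_powerCell (hac : μ ≪ volume)
    {y : ι → EuclideanSpace ℝ (Fin d)} (hy : Function.Injective y) (j : ι) :
    Continuous fun h : ι → ℝ => μ.real (powerCell y h j) := by
  refine continuous_iff_continuousAt.2 fun h => ?_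
  refine tendsto_measureReal_of_ae_eventually_iff (isOpen_powerCell y h j).measurableSet
    (fun h => (isOpen_powerCell y h j).measurableSet) ?_
  filter_upwards [ae_power_ne hac hy h] with z hz
  have hc : ∀ i, ContinuousAt (fun h : ι → ℝ => inner ℝ (y i) z + h i) h :=
    fun i => (continuous_const.add (continuous_apply i)).continuousAt
  have : ∀ᶠ h' in 𝓝 h, ∀ k, k ≠ j → (inner ℝ (y k) z + h' k < inner ℝ (y j) z + h' j ↔
      inner ℝ (y k) z + h k < inner ℝ (y j) z + h j) := by
    refine eventually_all.2 fun k => ?_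
    by_cases hk : k = j
    · exact Eventually.of_forall fun _ h' => absurd hk h'
    rcases lt_or_gt_of_ne (hz j k hk) with hlt | hlt
    · filter_upwards [(hc k).eventually_lt (hc j) hlt] with h' h1 _
      exact ⟨fun _ => hlt, fun _ => h1⟩
    · filter_upwards [(hc j).eventually_lt (hc k) hlt] with h' h1 _
      exact ⟨fun h2 => absurd h2 (not_lt.2 h1.le), fun h2 => absurd h2 (not_lt.2 hlt.le)⟩
  filter_upwards [this] with h' h1
  exact forall₂_congr h1

theorem sum_measureReal_powerCell [Nonempty ι] (hac : μ ≪ volume)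
    {y : ι → EuclideanSpace ℝ (Fin d)} (hy : Function.Injective y) (h : ι → ℝ) :
    ∑ j, μ.real (powerCell y h j) = 1 := by
  have h1 : μ.real (⋃ j, powerCell y h j) = 1 := by
    rw [← probReal_univ (μ := μ)]
    apply measureReal_congr
    filter_upwards [ae_exists_mem_powerCell hac hy h] with z hz
    exact propext ⟨fun _ => trivial, fun _ => Set.mem_iUnion.2 hz⟩
  rw [← h1, measureReal_iUnion_fintype (pairwise_disjoint_powerCell y h)
    fun j => (isOpen_powerCell y h j).measurableSet]

theorem tendsto_measureReal_gap (a b : EuclideanSpace ℝ (Fin d)) :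
    Tendsto (fun t : ℝ => μ.real {z | inner ℝ a z + t < inner ℝ b z}) atTop (𝓝 0) := by
  rw [← measureReal_empty (μ := μ)]
  refine tendsto_measureReal_of_ae_eventually_iff MeasurableSet.empty
    (fun t => (isOpen_lt (by fun_prop) (by fun_prop)).measurableSet) (ae_of_all _ fun z => ?_)
  filter_upwards [eventually_ge_atTop (inner ℝ b z - inner ℝ a z)] with t ht
  simp
  linarith

/-- Maximize the sum of the heights while no cell except that of a reference site `i₀` exceeds its
share. A cell below its share could be raised slightly, which only shrinks the others, so at a
maximum all these constraints are tight; the cell of `i₀` gets the rest. -/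
theorem exists_heights (hac : μ ≪ volume) {y : ι → EuclideanSpace ℝ (Fin d)}
    (hy : Function.Injective y) [Nonempty ι] {w : ι → ℝ} (hw : ∀ j, 0 < w j)
    (hw1 : ∑ j, w j = 1) : ∃ h : ι → ℝ, ∀ j, μ.real (powerCell y h j) = w j := by
  classical
  obtain ⟨i₀⟩ := ‹Nonempty ι›
  have : Nonempty ι := ⟨i₀⟩
  -- Heights `-S` make the other cells small enough to be admissible; a height above `R` would leave
  -- `i₀` less than its share. This confines the search to a compact box.
  obtain ⟨S, hS⟩ : ∃ S : ℝ, ∀ j, μ.real {z | inner ℝ (y i₀) z + S < inner ℝ (y j) z} < w j :=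
    (eventually_all.2 fun j =>
      (tendsto_measureReal_gap (y i₀) (y j)).eventually_lt_const (hw j)).exists
  obtain ⟨R, hR, hR0⟩ : ∃ R : ℝ,
      (∀ j, μ.real {z | inner ℝ (y j) z + R < inner ℝ (y i₀) z} < w i₀) ∧ 0 ≤ R :=
    ((eventually_all.2 fun j => (tendsto_measureReal_gap (y j) (y i₀)).eventually_lt_const
      (hw i₀)).and (eventually_ge_atTop 0)).exists
  let lo : ι → ℝ := fun j => if j = i₀ then 0 else -S
  let A : Set (ι → ℝ) := {h | h i₀ = 0 ∧ ∀ j, j ≠ i₀ → μ.real (powerCell y h j) ≤ w j}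
  have hAclosed : IsClosed A := by
    have : A = {h | h i₀ = 0} ∩ ⋂ j, ⋂ (_ : j ≠ i₀), {h | μ.real (powerCell y h j) ≤ w j} := by
      ext h; simp [A]
    rw [this]
    exact (isClosed_eq (by fun_prop) continuous_const).inter (isClosed_iInter fun j =>
      isClosed_iInter fun _ => isClosed_le (continuous_measureReal_powerCell hac hy j)
        continuous_const)
  have hmass : ∀ h ∈ A, w i₀ ≤ μ.real (powerCell y h i₀) := by
    intro h hh
    have h1 := sum_measureReal_powerCell (μ := μ) hac hy h
    rw [← Finset.add_sum_erase _ _ (Finset.mem_univ i₀)] at h1 hw1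
    have := Finset.sum_le_sum (s := Finset.univ.erase i₀) fun j hj =>
      hh.2 j (Finset.ne_of_mem_erase hj)
    linarith
  have hbdd : ∀ h ∈ A, ∀ j, h j ≤ R := by
    intro h hh j
    by_cases hj : j = i₀
    · rw [hj, hh.1]; exact hR0
    by_contra! hlt
    refine absurd (hmass h hh) (not_le.2 (lt_of_le_of_lt (measureReal_mono ?_) (hR j)))
    intro z hz
    have := hz j hj
    rw [hh.1] at this
    show inner ℝ (y j) z + R < inner ℝ (y i₀) z
    linarith
  have hlo : lo ∈ A := by
    refine ⟨by simp [lo], fun j hj => le_trans (measureReal_mono ?_) (hS j).le⟩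
    intro z hz
    have := hz i₀ (Ne.symm hj)
    simp only [lo, hj, if_true, if_false] at this
    show inner ℝ (y i₀) z + S < inner ℝ (y j) z
    linarith
  have hcomp : IsCompact (Set.Icc lo (fun _ => R) ∩ A) := isCompact_Icc.inter_right hAclosed
  obtain ⟨h, ⟨⟨hlow, -⟩, hA⟩, hmax⟩ := hcomp.exists_isMaxOn (f := fun h : ι → ℝ => ∑ j, h j)
    ⟨lo, ⟨le_rfl, fun j => hbdd lo hlo j⟩, hlo⟩ (by fun_prop)
  have heq : ∀ j, j ≠ i₀ → μ.real (powerCell y h j) = w j := by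
    intro j hj
    by_contra hne
    have hlt := lt_of_le_of_ne (hA.2 j hj) hne
    have hcont : Continuous fun ε : ℝ => μ.real (powerCell y (Function.update h j (h j + ε)) j) :=
      (continuous_measureReal_powerCell hac hy j).comp
        (continuous_const.update j (continuous_const.add continuous_id))
    have hev : ∀ᶠ ε : ℝ in 𝓝 0,
        μ.real (powerCell y (Function.update h j (h j + ε)) j) < w j :=
      hcont.continuousAt.eventually_lt_const (by simpa using hlt)
    obtain ⟨ε, hε, hεpos⟩ := ((hev.filter_mono nhdsWithin_le_nhds).and
      (self_mem_nhdsWithin : Set.Ioi (0 : ℝ) ∈ 𝓝[>] 0)).exists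
    have hεpos : 0 < ε := hεpos
    have hge : ∀ k, h k ≤ Function.update h j (h j + ε) k := by
      intro k
      by_cases hk : k = j
      · subst hk; simp [hεpos.le]
      · simp [hk]
    have hA' : Function.update h j (h j + ε) ∈ A := by
      refine ⟨by simpa [Ne.symm hj] using hA.1, fun k hk => ?_⟩
      by_cases hkj : k = j
      · subst hkj; exact hε.le
      · exact le_trans (measureReal_mono (powerCell_anti hge (by simp [hkj]))) (hA.2 k hk)
    have h2 : ∑ k, Function.update h j (h j + ε) k ≤ ∑ k, h k :=
      hmax ⟨⟨fun k => (hlow k).trans (hge k), fun k => hbdd _ hA' k⟩, hA'⟩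
    have h3 : ∑ k, h k < ∑ k, Function.update h j (h j + ε) k :=
      Finset.sum_lt_sum (fun k _ => hge k) ⟨j, Finset.mem_univ j, by simp [hεpos]⟩
    linarith
  refine ⟨h, fun j => ?_⟩
  by_cases hj : j = i₀
  · have h1 := sum_measureReal_powerCell (μ := μ) hac hy h
    rw [← Finset.add_sum_erase _ _ (Finset.mem_univ i₀)] at h1 hw1
    rw [Finset.sum_congr rfl fun k hk => heq k (Finset.ne_of_mem_erase hk)] at h1
    rw [hj]
    linarith
  · exact heq j hj

/-- The potential is the maximum of the affine functions `⟪y k, ·⟫ + h k`; on the open cell of `j`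
it coincides with the `j`-th one, whose gradient is `y j`. -/
theorem exists_isOTMap (hac : μ ≪ volume) {y : ι → EuclideanSpace ℝ (Fin d)}
    (hy : Function.Injective y) [Nonempty ι] {w : ι → ℝ} (hw : ∀ j, 0 < w j)
    (hw1 : ∑ j, w j = 1) :
    ∃ T, IsOTMap μ (∑ j, ENNReal.ofReal (w j) • Measure.dirac (y j)) T := by
  classical
  obtain ⟨h, hh⟩ := exists_heights (μ := μ) hac hy hw hw1
  let T : EuclideanSpace ℝ (Fin d) → EuclideanSpace ℝ (Fin d) :=
    fun z => ∑ j, (powerCell y h j).indicator (fun _ => y j) z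
  have hT : ∀ j, ∀ z ∈ powerCell y h j, T z = y j := by
    intro j z hz
    rw [show T z = ∑ j, (powerCell y h j).indicator (fun _ => y j) z from rfl,
      Finset.sum_eq_single j]
    · simp [hz]
    · intro k _ hk
      exact Set.indicator_of_notMem
        (Set.disjoint_right.1 (pairwise_disjoint_powerCell y h hk) hz) _
    · simp
  have hmeas : Measurable T := Finset.measurable_sum _ fun j _ =>
    measurable_const.indicator (isOpen_powerCell y h j).measurableSet
  let ψ : EuclideanSpace ℝ (Fin d) → ℝ :=
    fun z => Finset.univ.sup' Finset.univ_nonempty fun k => inner ℝ (y k) z + h k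
  refine ⟨T, hmeas, ?_, Set.univ, ψ, ⟨convex_univ, ?_⟩, ?_⟩
  · ext B hB
    rw [Measure.map_apply hmeas hB]
    have h1 : μ (T ⁻¹' B) = μ (⋃ j, T ⁻¹' B ∩ powerCell y h j) := by
      apply measure_congr
      filter_upwards [ae_exists_mem_powerCell hac hy h] with z hz
      refine propext ⟨fun hzB => ?_, fun hzB => ?_⟩
      · obtain ⟨j, hj⟩ := hz
        exact Set.mem_iUnion.2 ⟨j, hzB, hj⟩
      · obtain ⟨j, hj⟩ := Set.mem_iUnion.1 hzB
        exact hj.1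
    rw [h1, measure_iUnion (fun i j hij => (pairwise_disjoint_powerCell y h hij).mono
      Set.inter_subset_right Set.inter_subset_right)
      fun j => (hmeas hB).inter (isOpen_powerCell y h j).measurableSet, tsum_fintype,
      Measure.finsetSum_apply]
    refine Finset.sum_congr rfl fun j _ => ?_
    rw [Measure.smul_apply, Measure.dirac_apply' _ hB, ← hh j, ofReal_measureReal]
    by_cases hj : y j ∈ B
    · have : T ⁻¹' B ∩ powerCell y h j = powerCell y h j :=
        Set.inter_eq_right.2 fun z hz => by simpa [hT j z hz] using hj
      simp [this, hj]
    · have : T ⁻¹' B ∩ powerCell y h j = ∅ := by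
        ext z
        simp only [Set.mem_inter_iff, Set.mem_preimage, Set.mem_empty_iff_false, iff_false, not_and]
        intro hz hzj
        rw [hT j z hzj] at hz
        exact hj hz
      simp [this, hj]
  · intro p _ q _ a b ha hb hab
    refine Finset.sup'_le _ _ fun k hk => ?_
    have hp : inner ℝ (y k) p + h k ≤ ψ p :=
      Finset.le_sup' (fun k => inner ℝ (y k) p + h k) hk
    have hq : inner ℝ (y k) q + h k ≤ ψ q :=
      Finset.le_sup' (fun k => inner ℝ (y k) q + h k) hk
    rw [inner_add_right, real_inner_smul_right, real_inner_smul_right, smul_eq_mul, smul_eq_mul]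
    calc a * inner ℝ (y k) p + b * inner ℝ (y k) q + h k
        = a * (inner ℝ (y k) p + h k) + b * (inner ℝ (y k) q + h k) := by
          linear_combination -h k * hab
      _ ≤ a * ψ p + b * ψ q := by gcongr
  · filter_upwards [ae_exists_mem_powerCell hac hy h] with z ⟨j, hj⟩
    refine ⟨by simp, ?_⟩
    rw [hT j z hj]
    have hloc : ψ =ᶠ[𝓝 z] fun z' => inner ℝ (y j) z' + h j := by
      filter_upwards [(isOpen_powerCell y h j).mem_nhds hj] with z' hz'
      refine le_antisymm (Finset.sup'_le _ _ fun k _ => ?_)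
        (Finset.le_sup' (fun k => inner ℝ (y k) z' + h k) (Finset.mem_univ j))
      by_cases hk : k = j
      · rw [hk]
      · exact (hz' k hk).le
    refine HasGradientAt.congr_of_eventuallyEq ?_ hloc
    rw [hasGradientAt_iff_hasFDerivAt]
    exact ((innerSL ℝ (y j)).hasFDerivAt).add_const (h j)

theorem exists_isOTMap_finset (hac : μ ≪ volume) {s : Finset (EuclideanSpace ℝ (Fin d))}
    {w : EuclideanSpace ℝ (Fin d) → ℝ} (hw : ∀ y ∈ s, 0 < w y) (hw1 : ∑ y ∈ s, w y = 1) :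
    ∃ T, IsOTMap μ (∑ y ∈ s, ENNReal.ofReal (w y) • Measure.dirac y) T := by
  have hne : Nonempty s := by
    rw [Finset.nonempty_coe_sort, Finset.nonempty_iff_ne_empty]
    rintro rfl
    simp at hw1
  have := exists_isOTMap (μ := μ) hac (y := fun j : s => (j : EuclideanSpace ℝ (Fin d)))
    Subtype.val_injective (w := fun j => w j) (fun j => hw j j.2)
    (by rw [Finset.sum_coe_sort s w, hw1])
  rwa [Finset.sum_coe_sort s fun y => ENNReal.ofReal (w y) • Measure.dirac y] at this

end Existence

/-! ### The two monotonicity estimates. -/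

section Breakdown

variable {d : ℕ} {μ : Measure (EuclideanSpace ℝ (Fin d))}

theorem exists_measureReal_compl_ball_lt [IsProbabilityMeasure μ] (u : EuclideanSpace ℝ (Fin d))
    {ε : ℝ} (hε : 0 < ε) (r : ℝ) : ∃ R, r ≤ R ∧ μ.real (Metric.ball u R)ᶜ < ε := by
  have h : Tendsto (fun R : ℝ => μ.real (Metric.ball u R)ᶜ) atTop (𝓝 (μ.real ∅)) := by
    refine tendsto_measureReal_of_ae_eventually_iff MeasurableSet.empty
      (fun R => Metric.isOpen_ball.measurableSet.compl) (ae_of_all _ fun z => ?_)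
    filter_upwards [eventually_gt_atTop (dist z u)] with R hR
    simpa using hR
  rw [measureReal_empty] at h
  exact ((eventually_ge_atTop r).and (h.eventually_lt_const hε)).exists

theorem measure_pos_of_mem_support {s : Set (EuclideanSpace ℝ (Fin d))} (hs : IsOpen s)
    {p : EuclideanSpace ℝ (Fin d)} (hp : p ∈ μ.support) (hps : p ∈ s) : 0 < μ s :=
  (Measure.mem_support_iff_forall p).1 hp s (hs.mem_nhds hps)

theorem exists_support_mem_of_measure_pos {s : Set (EuclideanSpace ℝ (Fin d))} (hs : 0 < μ s) :
    ∃ p ∈ μ.support, p ∈ s := by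
  by_contra! h
  exact hs.ne' (measure_mono_null (fun p hp hp' => h p hp' hp) Measure.measure_compl_support)

/-- The gap between `c` and `c'` absorbs the error of the far-atom argument. If the mass is below
`m`, lower the boundary slightly below `u`. In case of equality the boundary must move past `u`, and
convexity of the support ensures that this loses mass while the ball still reaches beyond the new
boundary. -/
theorem exists_levels [IsProbabilityMeasure μ] (hac : μ ≪ volume) (hconv : Convex ℝ μ.support)
    {u v : EuclideanSpace ℝ (Fin d)} (hu : u ∈ μ.support) (hv : v ≠ 0) {m : ℝ} (hm : 0 < m)
    (hle : μ.real {z | 0 ≤ inner ℝ v (z - u)} ≤ m) {δ : ℝ} (hδ : 0 < δ) :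
    ∃ c c' : ℝ, c < c' ∧ μ.real {z | c ≤ inner ℝ v (z - u)} < m ∧
      0 < μ (Metric.ball u δ ∩ {z | c' ≤ inner ℝ v (z - u)}) := by
  have hpos : ∀ (c : ℝ) (p : EuclideanSpace ℝ (Fin d)), p ∈ μ.support → p ∈ Metric.ball u δ →
      c < inner ℝ v (p - u) → 0 < μ (Metric.ball u δ ∩ {z | c ≤ inner ℝ v (z - u)}) := by
    intro c p hp hpb hpc
    refine lt_of_lt_of_le (measure_pos_of_mem_support (s := Metric.ball u δ ∩
      {z | c < inner ℝ v (z - u)}) (Metric.isOpen_ball.inter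
        (isOpen_lt continuous_const (by fun_prop))) hp ⟨hpb, hpc⟩) (measure_mono ?_)
    exact fun z hz => ⟨hz.1, le_of_lt (show c < inner ℝ v (z - u) from hz.2)⟩
  rcases hle.lt_or_eq with hlt | heq
  · have hcont : ContinuousAt (fun c : ℝ => μ.real {z | c < inner ℝ v (z - u)}) 0 :=
      ContinuousAt.comp (f := fun c : ℝ => (v, c))
        (continuousAt_measureReal_openHalfspace hac u hv 0) (by fun_prop)
    rw [← measureReal_openHalfspace hac u hv] at hlt
    obtain ⟨c, hc, hc0⟩ := (((hcont.eventually_lt_const hlt).filter_mono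
      nhdsWithin_le_nhds).and (self_mem_nhdsWithin : Set.Iio (0 : ℝ) ∈ 𝓝[<] 0)).exists
    have hc0 : c < 0 := hc0
    refine ⟨c, c / 2, by linarith, ?_, hpos _ u hu (Metric.mem_ball_self hδ) (by simp; linarith)⟩
    rwa [← measureReal_openHalfspace hac u hv]
  · have h0 : 0 < μ {z | 0 < inner ℝ v (z - u)} := by
      rw [← measureReal_openHalfspace hac u hv] at heq
      have : μ.real {z | 0 < inner ℝ v (z - u)} ≠ 0 := by rw [heq]; exact hm.ne'
      exact pos_iff_ne_zero.2 fun h => this (by simp [measureReal_def, h])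
    obtain ⟨p, hp, hpa⟩ := exists_support_mem_of_measure_pos h0
    have hpa : 0 < inner ℝ v (p - u) := hpa
    set a := inner ℝ v (p - u) with ha
    have hseg : ∀ s : ℝ, 0 ≤ s → s ≤ 1 → u + s • (p - u) ∈ μ.support := fun s hs0 hs1 =>
      hconv.add_smul_sub_mem hu hp ⟨hs0, hs1⟩
    obtain ⟨s, hs, hs0⟩ : ∃ s : ℝ, (s * ‖p - u‖ < δ ∧ s < 1) ∧ 0 < s := by
      have h1 : Tendsto (fun s : ℝ => s * ‖p - u‖) (𝓝 0) (𝓝 (0 * ‖p - u‖)) :=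
        tendsto_id.mul_const _
      rw [zero_mul] at h1
      exact ((((h1.eventually_lt_const hδ).and (tendsto_id.eventually_lt_const one_pos)).filter_mono
        nhdsWithin_le_nhds).and (self_mem_nhdsWithin : Set.Ioi (0 : ℝ) ∈ 𝓝[>] 0)).exists
    have hsa : 0 < s * a := mul_pos hs0 hpa
    have hin : ∀ r : ℝ, inner ℝ v (u + r • (p - u) - u) = r * a := fun r => by
      rw [add_sub_cancel_left, real_inner_smul_right]
    -- The support points at levels `s * a / 4` and `s * a` show, respectively, that the slab cut
    -- off has mass and that the ball has mass above `c'`.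
    refine ⟨s * a / 2, 3 * (s * a) / 4, by linarith, ?_,
      hpos _ (u + s • (p - u)) (hseg s hs0.le hs.2.le) ?_ ?_⟩
    · have hslab : 0 < μ {z | 0 < inner ℝ v (z - u) ∧ inner ℝ v (z - u) < s * a / 2} := by
        refine measure_pos_of_mem_support (p := u + (s / 4) • (p - u)) ?_
          (hseg _ (by linarith) (by linarith [hs.2])) ⟨?_, ?_⟩
        · have hc : Continuous fun z : EuclideanSpace ℝ (Fin d) => inner ℝ v (z - u) := by fun_prop
          exact (isOpen_lt continuous_const hc).inter (isOpen_lt hc continuous_const)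
        · rw [hin]; linarith
        · rw [hin]; linarith
      have hslab' : 0 < μ.real {z | 0 < inner ℝ v (z - u) ∧ inner ℝ v (z - u) < s * a / 2} :=
        ENNReal.toReal_pos hslab.ne' (measure_ne_top _ _)
      have hun : μ.real ({z | 0 < inner ℝ v (z - u) ∧ inner ℝ v (z - u) < s * a / 2} ∪
          {z | s * a / 2 ≤ inner ℝ v (z - u)}) ≤ m := by
        refine le_trans (measureReal_mono ?_) hle
        rintro z (hz | hz)
        · exact hz.1.le
        · have hz : s * a / 2 ≤ inner ℝ v (z - u) := hz
          show 0 ≤ inner ℝ v (z - u)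
          linarith
      have hdisj : Disjoint {z | 0 < inner ℝ v (z - u) ∧ inner ℝ v (z - u) < s * a / 2}
          {z | s * a / 2 ≤ inner ℝ v (z - u)} :=
        Set.disjoint_left.2 fun z hz hz' => absurd hz.2 (not_lt.2 hz')
      rw [measureReal_union hdisj (measurableSet_closedHalfspace v u _)] at hun
      linarith
    · rw [Metric.mem_ball, dist_eq_norm, add_sub_cancel_left, norm_smul, Real.norm_eq_abs,
        abs_of_pos hs0]
      exact hs.1
    · rw [hin]; linarith

/-- Suppose `z₀` in the ball above level `c'` has a value of norm at most `M`. Monotonicity puts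
every `z` within `R` of `u` that is sent to `t • v` above level `c' - 2 * M * R / t`, hence above
`c`; such points are too few to carry mass `m`. -/
theorem exists_forall_eq_far_atom [IsProbabilityMeasure μ] (u v : EuclideanSpace ℝ (Fin d))
    {c c' m : ℝ} (hcc' : c < c') (hm : μ.real {z | c ≤ inner ℝ v (z - u)} < m) {M : ℝ}
    (hM : 0 ≤ M) (δ : ℝ) :
    ∃ t₀ : ℝ, ∀ t, t₀ ≤ t → ∀ (ν : Measure (EuclideanSpace ℝ (Fin d)))
      (T : EuclideanSpace ℝ (Fin d) → EuclideanSpace ℝ (Fin d)), IsOTMap μ ν T →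
      (∀ᵐ z ∂μ, T z = t • v ∨ ‖T z‖ ≤ M) → m ≤ μ.real {z | T z = t • v} →
      ∀ᵐ z ∂μ, z ∈ Metric.ball u δ → c' ≤ inner ℝ v (z - u) → T z = t • v := by
  obtain ⟨R, hδR, hR⟩ := exists_measureReal_compl_ball_lt (μ := μ) u (sub_pos.2 hm) δ
  -- The quotient makes the error `M * (2 * R)` at most `t * (c' - c)`; the `1` keeps `t` positive.
  refine ⟨max 1 (M * (2 * R) / (c' - c)), fun t ht ν T hT hval hmass => ?_⟩
  have ht1 : 0 < t := lt_of_lt_of_le one_pos ((le_max_left _ _).trans ht)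
  have ht2 : M * (2 * R) ≤ t * (c' - c) :=
    (div_le_iff₀ (sub_pos.2 hcc')).1 ((le_max_right _ _).trans ht)
  obtain ⟨G, hG, hmono⟩ := hT.exists_monotone
  filter_upwards [hG, hval] with z₀ hz₀ hv₀ hball hlev
  by_contra hne
  have hz₀M := hv₀.resolve_left hne
  refine absurd hmass (not_le.2 ?_)
  calc μ.real {z | T z = t • v}
      ≤ μ.real ({z | c ≤ inner ℝ v (z - u)} ∪ (Metric.ball u R)ᶜ) := by
        refine ENNReal.toReal_mono (measure_ne_top _ _) (measure_mono_ae ?_)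
        filter_upwards [hG] with z hz hTz
        have hTz : T z = t • v := hTz
        by_cases hzR : z ∈ Metric.ball u R
        · left
          show c ≤ inner ℝ v (z - u)
          have h1 := hmono z hz z₀ hz₀
          rw [hTz, inner_sub_left, real_inner_smul_left] at h1
          have h2 : ‖z - z₀‖ ≤ 2 * R := by
            rw [← dist_eq_norm]
            have := dist_triangle_right z z₀ u
            have h3 := Metric.mem_ball.1 hzR
            have h4 := Metric.mem_ball.1 hball
            linarith
          have h3 : -(M * (2 * R)) ≤ inner ℝ (T z₀) (z - z₀) := by
            refine (abs_le.1 ((abs_real_inner_le_norm _ _).trans ?_)).1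
            gcongr
          have h5 : inner ℝ v (z - z₀) = inner ℝ v (z - u) - inner ℝ v (z₀ - u) := by
            rw [← inner_sub_right, sub_sub_sub_cancel_right]
          rw [h5] at h1
          have h6 : t * (c - c') ≤ t * (inner ℝ v (z - u) - inner ℝ v (z₀ - u)) := by linarith
          have := le_of_mul_le_mul_left h6 ht1
          linarith
        · exact Or.inr hzR
    _ ≤ _ := measureReal_union_le _ _
    _ < m := by linarith

theorem exists_norm_le_of_lt_halfspaceDepth [IsProbabilityMeasure μ] (hac : μ ≪ volume)
    (u : EuclideanSpace ℝ (Fin d)) {m : ℝ} (hm : m < halfspaceDepth μ u) {M : ℝ} (hM : 0 ≤ M) :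
    ∃ δ, 0 < δ ∧ ∃ C, 0 ≤ C ∧ ∀ (ν : Measure (EuclideanSpace ℝ (Fin d)))
      (T : EuclideanSpace ℝ (Fin d) → EuclideanSpace ℝ (Fin d)), IsOTMap μ ν T →
      1 - m ≤ μ.real {z | ‖T z‖ ≤ M} → ∀ᵐ z ∂μ, z ∈ Metric.ball u δ → ‖T z‖ ≤ C := by
  obtain ⟨m', hmm', hm'⟩ := exists_between hm
  -- Compactness gives one shift `η` for all directions, needed because the direction of `T z₀` is
  -- not known in advance.
  have hev : ∀ᶠ η : ℝ in 𝓝 0, ∀ w ∈ Metric.sphere (0 : EuclideanSpace ℝ (Fin d)) 1,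
      m' < μ.real {z | η < inner ℝ w (z - u)} := by
    refine (isCompact_sphere _ _).eventually_forall_of_forall_eventually fun w hw => ?_
    have hw0 : w ≠ 0 := by
      rintro rfl
      simp at hw
    have hlt : m' < μ.real {z | 0 < inner ℝ w (z - u)} := by
      rw [measureReal_openHalfspace hac u hw0]
      exact hm'.trans_le (halfspaceDepth_le u hw0)
    have hc := (continuousAt_measureReal_openHalfspace (μ := μ) hac u hw0 0).comp
      (f := Prod.swap) (x := ((0 : ℝ), w)) continuous_swap.continuousAt
    exact hc.eventually_const_lt hlt
  obtain ⟨η, hη, hη0⟩ := ((hev.filter_mono nhdsWithin_le_nhds).and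
      (self_mem_nhdsWithin : Set.Ioi (0 : ℝ) ∈ 𝓝[>] 0)).exists
  have hη0 : 0 < η := hη0
  obtain ⟨R, hδR, hR⟩ := exists_measureReal_compl_ball_lt (μ := μ) u (sub_pos.2 hmm') η
  have hR0 : 0 ≤ R := hη0.le.trans hδR
  refine ⟨η / 2, half_pos hη0, M * (2 * R) / (η / 2), by positivity, fun ν T hT hmass => ?_⟩
  obtain ⟨G, hG, hmono⟩ := hT.exists_monotone
  filter_upwards [hG] with z₀ hz₀ hball
  by_contra! hlt
  have hy0 : 0 < ‖T z₀‖ := lt_of_le_of_lt (by positivity) hlt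
  have hyM : M * (2 * R) ≤ ‖T z₀‖ * (η / 2) := ((div_lt_iff₀ (half_pos hη0)).1 hlt).le
  set w := ‖T z₀‖⁻¹ • T z₀ with hw
  have hwn : ‖w‖ = 1 := by rw [hw, norm_smul, norm_inv, norm_norm, inv_mul_cancel₀ hy0.ne']
  have hTw : T z₀ = ‖T z₀‖ • w := by rw [hw, smul_smul, mul_inv_cancel₀ hy0.ne', one_smul]
  refine absurd hmass (not_le.2 ?_)
  have hcompl := probReal_compl_eq_one_sub (μ := μ) (measurableSet_openHalfspace w u η)
  calc μ.real {z | ‖T z‖ ≤ M}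
      ≤ μ.real ({z | η < inner ℝ w (z - u)}ᶜ ∪ (Metric.ball u R)ᶜ) := by
        refine ENNReal.toReal_mono (measure_ne_top _ _) (measure_mono_ae ?_)
        filter_upwards [hG] with z hz hTz
        have hTz : ‖T z‖ ≤ M := hTz
        by_cases hzR : z ∈ Metric.ball u R
        · left
          show ¬ η < inner ℝ w (z - u)
          rw [not_lt]
          have h1 := hmono z hz z₀ hz₀
          rw [inner_sub_left] at h1
          have h4 := Metric.mem_ball.1 hball
          have h2 : ‖z - z₀‖ ≤ 2 * R := by
            rw [← dist_eq_norm]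
            have := dist_triangle_right z z₀ u
            have h3 := Metric.mem_ball.1 hzR
            linarith
          have h3 : inner ℝ (T z) (z - z₀) ≤ M * (2 * R) := by
            refine (real_inner_le_norm _ _).trans ?_
            gcongr
          have h5 : inner ℝ w (z - z₀) = inner ℝ w (z - u) - inner ℝ w (z₀ - u) := by
            rw [← inner_sub_right, sub_sub_sub_cancel_right]
          have h6 : inner ℝ w (z₀ - u) ≤ η / 2 := by
            refine (real_inner_le_norm _ _).trans ?_
            rw [hwn, one_mul, ← dist_eq_norm]
            exact h4.le
          have h7 : inner ℝ (T z₀) (z - z₀) = ‖T z₀‖ * inner ℝ w (z - z₀) := by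
            conv_lhs => rw [hTw, real_inner_smul_left]
          rw [h7] at h1
          have := le_of_mul_le_mul_left (
            show ‖T z₀‖ * inner ℝ w (z - z₀) ≤ ‖T z₀‖ * (η / 2) by linarith) hy0
          linarith
        · exact Or.inr hzR
    _ ≤ _ := measureReal_union_le _ _
    _ < 1 - m := by
        rw [hcompl]
        linarith [hη w (by simpa using hwn)]

end Breakdown

/-! ### Contaminated measures and the breakdown criterion. -/

section Breakdown

variable {d n : ℕ} {μ : Measure (EuclideanSpace ℝ (Fin d))}

theorem sum_smul_dirac_singleton {s : Finset (EuclideanSpace ℝ (Fin d))}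
    (w : EuclideanSpace ℝ (Fin d) → ℝ) {y : EuclideanSpace ℝ (Fin d)} (hy : y ∈ s) :
    (∑ y ∈ s, ENNReal.ofReal (w y) • Measure.dirac y) {y} = ENNReal.ofReal (w y) := by
  rw [Measure.finsetSum_apply, Finset.sum_eq_single y]
  · simp
  · intro b _ hb
    simp [hb]
  · exact fun h => absurd hy h

theorem IsOTMap.ae_mem_finset {s : Finset (EuclideanSpace ℝ (Fin d))}
    {w : EuclideanSpace ℝ (Fin d) → ℝ} {T : EuclideanSpace ℝ (Fin d) → EuclideanSpace ℝ (Fin d)}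
    (hT : IsOTMap μ (∑ y ∈ s, ENNReal.ofReal (w y) • Measure.dirac y) T) :
    ∀ᵐ z ∂μ, T z ∈ s := by
  have h : μ (T ⁻¹' (s : Set (EuclideanSpace ℝ (Fin d)))ᶜ) = 0 := by
    rw [← Measure.map_apply hT.1 s.measurableSet.compl, hT.2.1, Measure.finsetSum_apply]
    refine Finset.sum_eq_zero fun y hy => ?_
    simp [hy]
  exact h

theorem discreteMeasure_eq_sum_image {x : Fin n → EuclideanSpace ℝ (Fin d)}
    (hx : Function.Injective x) (lam : Fin n → ℝ) [DecidableEq (EuclideanSpace ℝ (Fin d))] :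
    discreteMeasure x lam = ∑ y ∈ Finset.univ.image x,
      ENNReal.ofReal (Function.extend x lam 0 y) • Measure.dirac y := by
  rw [Finset.sum_image hx.injOn]
  exact Finset.sum_congr rfl fun i _ => by rw [hx.extend_apply]

theorem ae_norm_otMap_discreteMeasure_le {x : Fin n → EuclideanSpace ℝ (Fin d)}
    (hx : Function.Injective x) (lam : Fin n → ℝ) {M : ℝ} (hM0 : 0 ≤ M) (hM : ∀ i, ‖x i‖ ≤ M) :
    ∀ᵐ z ∂μ, ‖otMap μ (discreteMeasure x lam) z‖ ≤ M := by
  classical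
  rcases isOTMap_otMap_or_eq_zero (μ := μ) (discreteMeasure x lam) with h | h
  · have h' := h
    rw [discreteMeasure_eq_sum_image hx lam] at h'
    filter_upwards [h'.ae_mem_finset] with z hz
    obtain ⟨i, -, hi⟩ := Finset.mem_image.1 hz
    rw [discreteMeasure_eq_sum_image hx lam, ← hi]
    exact hM i
  · simp [h, hM0]

theorem exists_norm_bound (x : Fin n → EuclideanSpace ℝ (Fin d)) :
    ∃ M : ℝ, 0 ≤ M ∧ ∀ i, ‖x i‖ ≤ M :=
  ⟨∑ i, ‖x i‖, by positivity, fun i =>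
    Finset.single_le_sum (f := fun i => ‖x i‖) (fun _ _ => norm_nonneg _) (Finset.mem_univ i)⟩

theorem measureReal_preimage_singleton {ν : Measure (EuclideanSpace ℝ (Fin d))}
    {T : EuclideanSpace ℝ (Fin d) → EuclideanSpace ℝ (Fin d)} (hT : IsOTMap μ ν T)
    (y : EuclideanSpace ℝ (Fin d)) : μ.real {z | T z = y} = ν.real {y} := by
  rw [measureReal_def, measureReal_def, ← hT.2.1, Measure.map_apply hT.1 (measurableSet_singleton y)]
  rfl

theorem exists_contamination {x : Fin n → EuclideanSpace ℝ (Fin d)} {lam : Fin n → ℝ}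
    (hx : Function.Injective x) (hlam : ∀ i, 0 < lam i) (hsum : ∑ i, lam i = 1)
    {I : Finset (Fin n)} (hI : I.Nonempty) {p : EuclideanSpace ℝ (Fin d)} (hp : ∀ i, x i ≠ p) :
    ∃ (s : Finset (EuclideanSpace ℝ (Fin d))) (w : EuclideanSpace ℝ (Fin d) → ℝ),
      (∀ y ∈ s, 0 < w y) ∧ ∑ y ∈ s, w y = 1 ∧ (∀ y ∈ s, y = p ∨ ∃ i, x i = y) ∧
      p ∈ s ∧ w p = ∑ i ∈ I, lam i ∧
      ∑ y ∈ s, ENNReal.ofReal (w y) • Measure.dirac y ∈ contaminations x lam I := by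
  classical
  -- The default value of the extension is the weight of the new atom `p`, which lies outside the
  -- range of `x`.
  set w : EuclideanSpace ℝ (Fin d) → ℝ := Function.extend x lam fun _ => ∑ i ∈ I, lam i with hw
  have hwx : ∀ i, w (x i) = lam i := fun i => hx.extend_apply _ _ i
  have hwp : w p = ∑ i ∈ I, lam i := Function.extend_apply' _ _ _ fun ⟨i, hi⟩ => hp i hi
  have hpn : p ∉ Iᶜ.image x := fun h => by
    obtain ⟨i, -, hi⟩ := Finset.mem_image.1 h
    exact hp i hi
  have hpos : ∀ y ∈ insert p (Iᶜ.image x), 0 < w y := by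
    intro y hy
    rcases Finset.mem_insert.1 hy with rfl | hy
    · rw [hwp]; exact Finset.sum_pos (fun i _ => hlam i) hI
    · obtain ⟨i, -, rfl⟩ := Finset.mem_image.1 hy
      rw [hwx]; exact hlam i
  have htot : ∑ y ∈ insert p (Iᶜ.image x), w y = 1 := by
    rw [Finset.sum_insert hpn, Finset.sum_image hx.injOn, hwp, ← hsum,
      ← Finset.sum_add_sum_compl I lam]
    simp only [hwx]
  have hmem : ∀ i, i ∉ I → x i ∈ insert p (Iᶜ.image x) := fun i hi =>
    Finset.mem_insert_of_mem (Finset.mem_image_of_mem x (Finset.mem_compl.2 hi))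
  refine ⟨insert p (Iᶜ.image x), w, hpos, htot, ?_, Finset.mem_insert_self _ _, hwp,
    insert p (Iᶜ.image x), w, hpos, htot, rfl, hmem, fun i hi => ?_⟩
  · intro y hy
    rcases Finset.mem_insert.1 hy with rfl | hy
    · exact Or.inl rfl
    · obtain ⟨i, -, rfl⟩ := Finset.mem_image.1 hy
      exact Or.inr ⟨i, rfl⟩
  · rw [sum_smul_dirac_singleton w (hmem i hi), hwx]

theorem breaksDown_of_halfspaceDepth_le [IsProbabilityMeasure μ] (hd : 0 < d) (hac : μ ≪ volume)
    (hconv : Convex ℝ μ.support) {u : EuclideanSpace ℝ (Fin d)} (hu : u ∈ μ.support)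
    {x : Fin n → EuclideanSpace ℝ (Fin d)} {lam : Fin n → ℝ} (hx : Function.Injective x)
    (hlam : ∀ i, 0 < lam i) (hsum : ∑ i, lam i = 1) {I : Finset (Fin n)} (hI : I.Nonempty)
    (hle : halfspaceDepth μ u ≤ ∑ i ∈ I, lam i) : BreaksDown μ x lam u I := by
  intro δ hδ
  obtain ⟨v, hv1, hv⟩ := exists_measureReal_eq_halfspaceDepth hd hac u
  have hv0 : v ≠ 0 := by
    rintro rfl
    simp at hv1
  have hIpos : 0 < ∑ i ∈ I, lam i := Finset.sum_pos (fun i _ => hlam i) hI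
  obtain ⟨c, c', hcc', hc, hpos⟩ := exists_levels hac hconv hu hv0 hIpos (hv.trans_le hle) hδ
  obtain ⟨M, hM0, hM⟩ := exists_norm_bound x
  obtain ⟨t₀, ht₀⟩ := exists_forall_eq_far_atom u v hcc' hc hM0 δ
  set B := Metric.ball u δ ∩ {z | c' ≤ inner ℝ v (z - u)} with hB
  have hBm : MeasurableSet B :=
    Metric.isOpen_ball.measurableSet.inter (measurableSet_closedHalfspace v u c')
  have hκ : 0 < μ.real B := ENNReal.toReal_pos hpos.ne' (measure_ne_top _ _)
  refine ENNReal.eq_top_of_forall_nnreal_le fun K => ?_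
  -- This gives `K ≤ (t - M) * μ.real B`; the `1` makes `t` exceed `M`, so `t • v` is a new atom.
  set t := max t₀ (M + K / μ.real B + 1) with ht
  have htM : M + K / μ.real B + 1 ≤ t := le_max_right _ _
  have hKB : 0 ≤ K / μ.real B := by positivity
  have ht0 : 0 < t := by linarith
  have hnorm : ‖t • v‖ = t := by rw [norm_smul, hv1, mul_one, Real.norm_of_nonneg ht0.le]
  have hne : ∀ i, x i ≠ t • v := fun i hi => by
    have := hM i
    rw [hi, hnorm] at this
    linarith
  obtain ⟨s, w, hw, hw1, hs, hps, hwp, hcont⟩ := exists_contamination hx hlam hsum hI hne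
  set ν' := ∑ y ∈ s, ENNReal.ofReal (w y) • Measure.dirac y with hν'
  have hT : IsOTMap μ ν' (otMap μ ν') := isOTMap_otMap (exists_isOTMap_finset hac hw hw1)
  have hval : ∀ᵐ z ∂μ, otMap μ ν' z = t • v ∨ ‖otMap μ ν' z‖ ≤ M := by
    filter_upwards [hT.ae_mem_finset] with z hz
    rcases hs _ hz with h | ⟨i, hi⟩
    · exact Or.inl h
    · exact Or.inr (hi ▸ hM i)
  have hfar := ht₀ t (le_max_left _ _) ν' _ hT hval (by
    rw [measureReal_preimage_singleton hT, measureReal_def, hν', sum_smul_dirac_singleton w hps,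
      hwp, ENNReal.toReal_ofReal hIpos.le])
  refine le_trans ?_ (le_iSup₂ (f := fun ν' (_ : ν' ∈ contaminations x lam I) =>
    ∫⁻ y in Metric.ball u δ, ‖otMap μ (discreteMeasure x lam) y - otMap μ ν' y‖ₑ ∂μ) ν' hcont)
  calc (K : ENNReal) ≤ ENNReal.ofReal (t - M) * μ B := by
        rw [← ofReal_measureReal (μ := μ) (s := B), ← ENNReal.ofReal_mul (by linarith),
          ← ENNReal.ofReal_coe_nnreal]
        refine ENNReal.ofReal_le_ofReal ?_
        rw [← div_le_iff₀ hκ]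
        linarith
    _ = ∫⁻ _ in B, ENNReal.ofReal (t - M) ∂μ := by rw [setLIntegral_const]
    _ ≤ ∫⁻ y in B, ‖otMap μ (discreteMeasure x lam) y - otMap μ ν' y‖ₑ ∂μ := by
        refine setLIntegral_mono_ae' hBm ?_
        filter_upwards [hfar, ae_norm_otMap_discreteMeasure_le (μ := μ) hx lam hM0 hM]
          with z h1 h2 hz
        rw [h1 hz.1 hz.2, ← ofReal_norm]
        refine ENNReal.ofReal_le_ofReal ?_
        have := norm_sub_norm_le (t • v) (otMap μ (discreteMeasure x lam) z)
        rw [hnorm, norm_sub_rev] at this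
        linarith
    _ ≤ _ := lintegral_mono_set Set.inter_subset_left

theorem not_breaksDown_empty {x : Fin n → EuclideanSpace ℝ (Fin d)} {lam : Fin n → ℝ}
    (hx : Function.Injective x) (hlam : ∀ i, 0 < lam i) (hsum : ∑ i, lam i = 1)
    (u : EuclideanSpace ℝ (Fin d)) : ¬ BreaksDown μ x lam u ∅ := by
  classical
  intro h
  have h1 := h 1 one_pos
  refine ENNReal.top_ne_zero (h1.symm.trans (le_antisymm (iSup₂_le fun ν' hν' => ?_) bot_le))
  obtain ⟨s, w, hw, hw1, rfl, hs, hmass⟩ := hν'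
  have hwx : ∀ i, w (x i) = lam i := fun i => by
    have := hmass i (Finset.notMem_empty i)
    rw [sum_smul_dirac_singleton w (hs i (Finset.notMem_empty i))] at this
    exact (ENNReal.ofReal_eq_ofReal_iff (hw _ (hs i (Finset.notMem_empty i))).le (hlam i).le).1 this
  have hsub : Finset.univ.image x ⊆ s := fun y hy => by
    obtain ⟨i, -, rfl⟩ := Finset.mem_image.1 hy
    exact hs i (Finset.notMem_empty i)
  have hseq : Finset.univ.image x = s := by
    refine hsub.antisymm fun y hy => ?_
    by_contra hn
    have h2 := Finset.sum_lt_sum_of_subset hsub hy hn (hw y hy) fun j hj _ => (hw j hj).le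
    rw [hw1, Finset.sum_image hx.injOn] at h2
    simp only [hwx, hsum] at h2
    exact lt_irrefl _ h2
  have heq : ∑ y ∈ s, ENNReal.ofReal (w y) • Measure.dirac y = discreteMeasure x lam := by
    rw [← hseq, Finset.sum_image hx.injOn]
    exact Finset.sum_congr rfl fun i _ => by rw [hwx]
  simp [heq]

theorem not_breaksDown_of_lt_halfspaceDepth [IsProbabilityMeasure μ] (hac : μ ≪ volume)
    {u : EuclideanSpace ℝ (Fin d)} {x : Fin n → EuclideanSpace ℝ (Fin d)} {lam : Fin n → ℝ}
    (hx : Function.Injective x) (hlam : ∀ i, 0 < lam i) (hsum : ∑ i, lam i = 1)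
    {I : Finset (Fin n)} (hlt : ∑ i ∈ I, lam i < halfspaceDepth μ u) :
    ¬ BreaksDown μ x lam u I := by
  classical
  intro h
  obtain ⟨M, hM0, hM⟩ := exists_norm_bound x
  obtain ⟨δ, hδ, C, hC0, hC⟩ := exists_norm_le_of_lt_halfspaceDepth hac u hlt hM0
  refine ENNReal.ofReal_ne_top (r := M + C) (top_le_iff.1 ((h δ hδ).symm.le.trans
    (iSup₂_le fun ν' hν' => ?_)))
  -- Existence is not needed here: the default map `0` satisfies the bound too.
  have hbound : ∀ᵐ z ∂μ, z ∈ Metric.ball u δ → ‖otMap μ ν' z‖ ≤ C := by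
    rcases isOTMap_otMap_or_eq_zero (μ := μ) ν' with hT | hT
    · refine hC ν' _ hT ?_
      obtain ⟨-, -, -, -, -, -, hmass⟩ := hν'
      have hsingle : ∀ i ∈ Iᶜ, μ.real {z | otMap μ ν' z = x i} = lam i := fun i hi => by
        rw [measureReal_preimage_singleton hT, measureReal_def, hmass i (Finset.mem_compl.1 hi),
          ENNReal.toReal_ofReal (hlam i).le]
      calc 1 - ∑ i ∈ I, lam i = ∑ i ∈ Iᶜ, μ.real {z | otMap μ ν' z = x i} := by
            rw [Finset.sum_congr rfl hsingle, ← hsum, ← Finset.sum_add_sum_compl I lam]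
            ring
        _ = μ.real (⋃ i ∈ Iᶜ, {z | otMap μ ν' z = x i}) := by
            rw [measureReal_biUnion_finset]
            · intro i _ j _ hij
              exact Set.disjoint_left.2 fun z hi hj => hij (hx (Eq.trans (Eq.symm hi) hj))
            · exact fun i _ => hT.1 (measurableSet_singleton (x i))
        _ ≤ μ.real {z | ‖otMap μ ν' z‖ ≤ M} := by
            refine measureReal_mono (Set.iUnion₂_subset fun i _ z hz => ?_)
            have hz : otMap μ ν' z = x i := hz
            show ‖otMap μ ν' z‖ ≤ M
            rw [hz]; exact hM i
    · exact ae_of_all _ fun z _ => by simp [hT, hC0]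
  calc ∫⁻ y in Metric.ball u δ, ‖otMap μ (discreteMeasure x lam) y - otMap μ ν' y‖ₑ ∂μ
      ≤ ∫⁻ _ in Metric.ball u δ, ENNReal.ofReal (M + C) ∂μ := by
        refine setLIntegral_mono_ae' Metric.isOpen_ball.measurableSet ?_
        filter_upwards [hbound, ae_norm_otMap_discreteMeasure_le (μ := μ) hx lam hM0 hM]
          with z h1 h2 hz
        rw [← ofReal_norm]
        exact ENNReal.ofReal_le_ofReal ((norm_sub_le _ _).trans (add_le_add h2 (h1 hz)))
    _ = ENNReal.ofReal (M + C) * μ (Metric.ball u δ) := by rw [setLIntegral_const]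
    _ ≤ ENNReal.ofReal (M + C) := mul_le_of_le_one_right' prob_le_one

theorem breaksDown_iff [IsProbabilityMeasure μ] (hd : 0 < d) (hac : μ ≪ volume)
    (hconv : Convex ℝ μ.support) {u : EuclideanSpace ℝ (Fin d)} (hu : u ∈ μ.support)
    {x : Fin n → EuclideanSpace ℝ (Fin d)} {lam : Fin n → ℝ} (hx : Function.Injective x)
    (hlam : ∀ i, 0 < lam i) (hsum : ∑ i, lam i = 1) (I : Finset (Fin n)) :
    BreaksDown μ x lam u I ↔ I.Nonempty ∧ halfspaceDepth μ u ≤ ∑ i ∈ I, lam i := by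
  refine ⟨fun h => ⟨?_, ?_⟩, fun h =>
    breaksDown_of_halfspaceDepth_le hd hac hconv hu hx hlam hsum h.1 h.2⟩
  · rw [Finset.nonempty_iff_ne_empty]
    rintro rfl
    exact not_breaksDown_empty hx hlam hsum u h
  · by_contra! hlt
    exact not_breaksDown_of_lt_halfspaceDepth hac hx hlam hsum hlt h

theorem breakdownMasses_eq [IsProbabilityMeasure μ] (hd : 0 < d) (hac : μ ≪ volume)
    (hconv : Convex ℝ μ.support) {u : EuclideanSpace ℝ (Fin d)} (hu : u ∈ μ.support)
    {x : Fin n → EuclideanSpace ℝ (Fin d)} {lam : Fin n → ℝ} (hx : Function.Injective x)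
    (hlam : ∀ i, 0 < lam i) (hsum : ∑ i, lam i = 1) :
    breakdownMasses μ x lam u = {m : ℝ | ∃ I : Finset (Fin n), I.Nonempty ∧
      halfspaceDepth μ u ≤ ∑ i ∈ I, lam i ∧ m = ∑ i ∈ I, lam i} := by
  ext m
  simp only [breakdownMasses, Set.mem_ofPred_eq, breaksDown_iff hd hac hconv hu hx hlam hsum,
    and_assoc]

theorem halfspaceDepth_le_one [IsProbabilityMeasure μ] (hd : 0 < d) (hac : μ ≪ volume)
    (u : EuclideanSpace ℝ (Fin d)) : halfspaceDepth μ u ≤ 1 := by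
  obtain ⟨v, -, hv⟩ := exists_measureReal_eq_halfspaceDepth hd hac u
  rw [← hv]
  exact measureReal_le_one

theorem halfspaceDepth_nonneg (u : EuclideanSpace ℝ (Fin d)) : 0 ≤ halfspaceDepth μ u := by
  refine Real.sInf_nonneg ?_
  rintro m ⟨H, -, -, rfl⟩
  exact measureReal_nonneg

theorem isLeast_breakdownPoint [IsProbabilityMeasure μ] (hd : 0 < d) (hac : μ ≪ volume)
    (hconv : Convex ℝ μ.support) {u : EuclideanSpace ℝ (Fin d)} (hu : u ∈ μ.support)
    {x : Fin n → EuclideanSpace ℝ (Fin d)} {lam : Fin n → ℝ} (hx : Function.Injective x)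
    (hlam : ∀ i, 0 < lam i) (hsum : ∑ i, lam i = 1) :
    IsLeast (breakdownMasses μ x lam u) (breakdownPoint μ x lam u) := by
  have hfin : (breakdownMasses μ x lam u).Finite := by
    refine (Set.finite_range fun I : Finset (Fin n) => ∑ i ∈ I, lam i).subset ?_
    rintro m ⟨I, -, rfl⟩
    exact ⟨I, rfl⟩
  have hne : (breakdownMasses μ x lam u).Nonempty := by
    rw [breakdownMasses_eq hd hac hconv hu hx hlam hsum]
    refine ⟨_, Finset.univ, ?_, ?_, rfl⟩
    · rw [Finset.nonempty_iff_ne_empty]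
      intro h
      rw [h] at hsum
      simp at hsum
    · rw [hsum]; exact halfspaceDepth_le_one hd hac u
  exact ⟨hne.csInf_mem hfin, fun m hm => csInf_le hfin.bddBelow hm⟩

/-! ### Empirical measures: the ceiling formula and its limit. -/

theorem isLeast_empirical {h : ℝ} (h0 : 0 ≤ h) (h1 : h ≤ 1) (hn : 0 < n) :
    IsLeast {m : ℝ | ∃ I : Finset (Fin n), I.Nonempty ∧ h ≤ ∑ _i ∈ I, (1 : ℝ) / n ∧
      m = ∑ _i ∈ I, (1 : ℝ) / n} ((modCeil (n * h) : ℝ) / n) := by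
  have hn' : (0 : ℝ) < n := Nat.cast_pos.2 hn
  have hsum : ∀ I : Finset (Fin n), ∑ _i ∈ I, (1 : ℝ) / n = (I.card : ℝ) / n := fun I => by
    rw [Finset.sum_const, nsmul_eq_mul, mul_one_div]
  simp only [hsum]
  -- The convention `modCeil 0 = 1` matches the requirement that `I` be nonempty.
  have hpos : 1 ≤ modCeil (n * h) := by
    unfold modCeil
    split_ifs with hz
    · exact le_rfl
    · exact Int.one_le_ceil_iff.2 (lt_of_le_of_ne (by positivity) (Ne.symm hz))
  have hle : modCeil (n * h) ≤ n := by
    unfold modCeil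
    split_ifs with hz
    · exact_mod_cast hn
    · refine Int.ceil_le.2 ?_
      push_cast
      exact mul_le_of_le_one_right hn'.le h1
  have hge : (n : ℝ) * h ≤ modCeil (n * h) := by
    unfold modCeil
    split_ifs with hz
    · rw [hz]; norm_num
    · exact Int.le_ceil _
  constructor
  · obtain ⟨k, hk⟩ := Int.eq_ofNat_of_zero_le (zero_le_one.trans hpos)
    rw [hk] at hpos hle hge ⊢
    obtain ⟨I, -, hI⟩ := Finset.exists_subset_card_eq (s := (Finset.univ : Finset (Fin n)))
      (n := k) (by rw [Finset.card_fin]; exact_mod_cast hle)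
    refine ⟨I, Finset.card_pos.1 (by rw [hI]; exact_mod_cast hpos), ?_, ?_⟩
    · rw [hI, le_div_iff₀ hn', mul_comm]
      exact_mod_cast hge
    · rw [hI]; simp
  · rintro m ⟨I, hI, hIh, rfl⟩
    refine div_le_div_of_nonneg_right ?_ hn'.le
    have hcard : modCeil (n * h) ≤ (I.card : ℤ) := by
      unfold modCeil
      split_ifs with hz
      · exact_mod_cast hI.card_pos
      · refine Int.ceil_le.2 ?_
        rw [le_div_iff₀ hn', mul_comm] at hIh
        exact_mod_cast hIh
    exact_mod_cast hcard

theorem breakdownPoint_empirical [IsProbabilityMeasure μ] (hd : 0 < d) (hac : μ ≪ volume)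
    (hconv : Convex ℝ μ.support) {u : EuclideanSpace ℝ (Fin d)} (hu : u ∈ μ.support)
    {x : Fin n → EuclideanSpace ℝ (Fin d)} (hn : 0 < n) (hx : Function.Injective x) :
    breakdownPoint μ x (fun _ => (1 : ℝ) / n) u = (modCeil (n * halfspaceDepth μ u) : ℝ) / n := by
  have hn' : (0 : ℝ) < n := Nat.cast_pos.2 hn
  have hlam : ∀ _i : Fin n, (0 : ℝ) < 1 / n := fun _ => by positivity
  have hsum : ∑ _i : Fin n, (1 : ℝ) / n = 1 := by
    rw [Finset.sum_const, Finset.card_fin, nsmul_eq_mul, mul_one_div_cancel hn'.ne']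
  have h1 := isLeast_breakdownPoint hd hac hconv hu hx hlam hsum
  rw [breakdownMasses_eq hd hac hconv hu hx hlam hsum] at h1
  exact h1.unique (isLeast_empirical (halfspaceDepth_nonneg u) (halfspaceDepth_le_one hd hac u) hn)

theorem tendsto_modCeil_div (h : ℝ) :
    Tendsto (fun n : ℕ => (modCeil (n * h) : ℝ) / n) atTop (𝓝 h) := by
  have hlim : Tendsto (fun n : ℕ => h + 1 / (n : ℝ)) atTop (𝓝 h) := by
    simpa using tendsto_const_nhds.add (tendsto_one_div_atTop_nhds_zero_nat (𝕜 := ℝ))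
  refine tendsto_of_tendsto_of_tendsto_of_le_of_le' tendsto_const_nhds hlim ?_ ?_
  · filter_upwards [eventually_gt_atTop 0] with n hn
    rw [le_div_iff₀ (Nat.cast_pos.2 hn), mul_comm]
    unfold modCeil
    split_ifs with hz
    · rw [hz]; norm_num
    · exact Int.le_ceil _
  · filter_upwards [eventually_gt_atTop 0] with n hn
    have hn' : (0 : ℝ) < n := Nat.cast_pos.2 hn
    rw [div_le_iff₀ hn', add_mul, one_div_mul_cancel hn'.ne', mul_comm h]
    unfold modCeil
    split_ifs with hz
    · rw [hz]; norm_num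
    · exact (Int.ceil_lt_add_one _).le

end Breakdown

end SemiDiscreteOT

theorem theorem3 {d : ℕ} (hd : 0 < d) (μ : Measure (EuclideanSpace ℝ (Fin d)))
    [IsProbabilityMeasure μ] (hac : μ ≪ volume) (hconv : Convex ℝ μ.support)
    (u : EuclideanSpace ℝ (Fin d)) (hu : u ∈ μ.support) :
    (∀ (n : ℕ) (x : Fin n → EuclideanSpace ℝ (Fin d)) (lam : Fin n → ℝ),
      Function.Injective x → (∀ i, 0 < lam i) → ∑ i, lam i = 1 →
        IsLeast (SemiDiscreteOT.breakdownMasses μ x lam u)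
          (SemiDiscreteOT.breakdownPoint μ x lam u) ∧
        IsLeast {m : ℝ | ∃ I : Finset (Fin n), I.Nonempty ∧
            SemiDiscreteOT.halfspaceDepth μ u ≤ ∑ i ∈ I, lam i ∧ m = ∑ i ∈ I, lam i}
          (SemiDiscreteOT.breakdownPoint μ x lam u)) ∧
    (∀ (n : ℕ) (x : Fin n → EuclideanSpace ℝ (Fin d)),
      0 < n → Function.Injective x →
        SemiDiscreteOT.breakdownPoint μ x (fun _ => (1 : ℝ) / n) u =
          (SemiDiscreteOT.modCeil (n * SemiDiscreteOT.halfspaceDepth μ u) : ℝ) / n) ∧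
    (∀ x : (n : ℕ) → Fin n → EuclideanSpace ℝ (Fin d),
      (∀ n, Function.Injective (x n)) →
        Tendsto (fun n : ℕ => SemiDiscreteOT.breakdownPoint μ (x n) (fun _ => (1 : ℝ) / n) u)
          atTop (𝓝 (SemiDiscreteOT.halfspaceDepth μ u))) := by
  refine ⟨fun n x lam hx hlam hsum => ?_, fun n x hn hx =>
    SemiDiscreteOT.breakdownPoint_empirical hd hac hconv hu hn hx, fun x hx => ?_⟩
  · have h := SemiDiscreteOT.isLeast_breakdownPoint hd hac hconv hu hx hlam hsum
    refine ⟨h, ?_⟩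
    rwa [SemiDiscreteOT.breakdownMasses_eq hd hac hconv hu hx hlam hsum] at h
  · refine (SemiDiscreteOT.tendsto_modCeil_div _).congr' ?_
    filter_upwards [eventually_gt_atTop 0] with n hn
    exact (SemiDiscreteOT.breakdownPoint_empirical hd hac hconv hu hn (hx n)).symm
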